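/- Let $\mathcal H$ be a real Hilbert space and let $S\colon\mathcal H\to\mathcal H$ be a bounded, linear, self-adjoint and strongly positive operator, i.e. $\langle Sx,x\rangle\ge m\|x\|^2$ for all $x\in\mathcal H$ and some $m>0$. Write $\|x\|_S=\sqrt{\langle Sx,x\rangle}$ and $\|x\|_{S^{-1}}=\sqrt{\langle S^{-1}x,x\rangle}$. Let $A\colon\mathcal H\to 2^{\mathcal H}$ be maximally monotone, and let $C\colon\mathcal H\to\mathcal H$ and $\ell\ge 0$ be such that either $\ell>0$ and $C$ is $\ell^{-1}$-cocoercive with respect to $S$, i.e. $$\langle Cx-Cy,x-y\rangle\ge\ell^{-1}\|Cx-Cy\|_{S^{-1}}^2\quad\text{for all }x,y\in\mathcal H,$$ or $C=0$ and $\ell=0$. Assume that $\operatorname{zer}(A+C)=\{x\in\mathcal H: 0\in Ax+Cx\}$ is nonempty. For each $k\in\mathbb N=\{0,1,\dots\}$ let $\gamma_k\in\mathbb R$, $L_k\ge 0$ and $M_k\colon\mathcal H\to\mathcal H$ (possibly nonlinear) be such that $\gamma_k M_k-S$ is $L_k$-Lipschitz continuous with respect to $S$, i.e. $$\|(\gamma_kM_k-S)x-(\gamma_kM_k-S)y\|_{S^{-1}}\le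 L_k\|x-y\|_S\quad\text{for all }x,y\in\mathcal H,$$ and assume that there is $\gamma>0$ with $\gamma_k\ge\gamma$ for all $k\in\mathbb N$. Let $\theta<1$, and assume that there is $\varepsilon>0$ such that $$1-\theta-2|\theta|-L_{k-1}-L_k-\gamma_k\tfrac{\ell}{2}\ge\varepsilon\quad\text{for all }k\ge 1.$$ Then, for all $x_{-1},x_0,u_0\in\mathcal H$, the iteration $$x_{k+1}=(M_k+A)^{-1}\bigl(M_kx_k-Cx_k+\gamma_k^{-1}u_k+\gamma_k^{-1}\theta S(x_k-x_{k-1})\bigr),$$ $$u_{k+1}=(\gamma_kM_k-S)x_{k+1}-(\gamma_kM_k-S)x_k,\qquad k\in\mathbb N,$$ generates uniquely determined infinite sequences $(x_k)_{k\in\mathbb N}$ and $(u_k)_{k\in\mathbb N}$, and, as $k\to\infty$: 1. $x_{k+1}-x_k\to 0$; 2. $u_k\to 0$; 3. $M_kx_k-M_kx_{k+1}+\gamma_k^{-1}u_k+\gamma_k^{-1}\theta S(x_k-x_{k-1})+Cx_{k+1}-Cx_k\in(A+C)x_{k+1}$ for every $k\in\mathbb N$, and these elements converge (strongly) to $0$;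 4. $(x_k)_{k\in\mathbb N}$ converges weakly to some $x^\star\in\operatorname{zer}(A+C)$. -/

import Mathlib

open Filter Topology
open scoped Pointwise

namespace NonlinearFB

section

variable {H : Type*} [NormedAddCommGroup H] [InnerProductSpace ℝ H]

/-- The class `𝒫(H)`: bounded linear operators on `H` that are self-adjoint and strongly positive. -/
def IsStronglyPositive [CompleteSpace H] (S : H →L[ℝ] H) : Prop :=
  IsSelfAdjoint S ∧ ∃ m : ℝ, 0 < m ∧ ∀ x : H, m * ‖x‖ ^ 2 ≤ inner ℝ (S x) x

/-- The scaled norm `‖x‖_S = √⟨S x, x⟩`. -/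
noncomputable def scaledNorm (S : H →L[ℝ] H) (x : H) : ℝ :=
  √(inner ℝ (S x) x)

/-- Every strongly positive self-adjoint operator is invertible, so that
`ContinuousLinearMap.inverse S`, used below, is its genuine inverse. -/
theorem IsStronglyPositive.isInvertible [CompleteSpace H] {S : H →L[ℝ] H}
    (hS : IsStronglyPositive S) : S.IsInvertible := by
  obtain ⟨_, m, hm, h⟩ := hS
  have hu : IsUnit S := by
    refine ContinuousLinearMap.isUnit_of_forall_le_norm_inner_map S (c := ⟨m, hm.le⟩) hm ?_
    intro x
    have h1 := h x
    rw [mul_comm] at h1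
    exact h1.trans (le_abs_self _)
  obtain ⟨e, he⟩ := hu
  exact ⟨ContinuousLinearEquiv.ofUnit e, by ext x; rw [← he]; rfl⟩

/-- `B` is `L`-Lipschitz continuous with respect to `S`:
`L ≥ 0` and `‖B x - B y‖_{S⁻¹} ≤ L ‖x - y‖_S` for all `x, y`. -/
def IsLipschitzWrt (S : H →L[ℝ] H) (L : ℝ) (B : H → H) : Prop :=
  0 ≤ L ∧ ∀ x y : H, scaledNorm S.inverse (B x - B y) ≤ L * scaledNorm S (x - y)

/-- `C` is `μ`-cocoercive with respect to `S`:
`⟨C x - C y, x - y⟩ ≥ μ ‖C x - C y‖²_{S⁻¹}` for all `x, y`. -/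
def IsCocoerciveWrt (S : H →L[ℝ] H) (μ : ℝ) (C : H → H) : Prop :=
  ∀ x y : H, μ * scaledNorm S.inverse (C x - C y) ^ 2 ≤ inner ℝ (C x - C y) (x - y)

/-- The graph of a set-valued operator. -/
def gra (A : H → Set H) : Set (H × H) := {p | p.2 ∈ A p.1}

/-- Monotonicity of a set-valued operator. -/
def IsMonotoneOp (A : H → Set H) : Prop :=
  ∀ p ∈ gra A, ∀ q ∈ gra A, 0 ≤ inner ℝ (p.2 - q.2) (p.1 - q.1)

/-- Maximal monotonicity: the operator is monotone and its graph is not a proper subset of the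
graph of another monotone operator. -/
def IsMaximallyMonotone (A : H → Set H) : Prop :=
  IsMonotoneOp A ∧ ∀ B : H → Set H, IsMonotoneOp B → ¬ gra A ⊂ gra B

/-- The sum `A + T` of a set-valued operator and a single-valued one. -/
def addOp (A : H → Set H) (T : H → H) : H → Set H := fun x => A x + {T x}

/-- The inverse of a set-valued operator. -/
def invOp (B : H → Set H) : H → Set H := fun z => {x | z ∈ B x}

/-- The set of zeros of a set-valued operator. -/
def zer (B : H → Set H) : Set H := {x | 0 ∈ B x}

/-- The iterate `x_{k-1}` for `k ∈ ℕ`, where `xm` is the extra initial point `x_{-1}`. -/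
def prev (xm : H) (x : ℕ → H) : ℕ → H
  | 0 => xm
  | k + 1 => x k

/-- The sequences `x` and `u` are generated by the nonlinear forward-backward method with momentum
correction and additional momentum, started at `x_{-1} = xm`, `x_0 = x0`, `u_0 = u0`:
`x_{k+1} = (M_k + A)⁻¹ (M_k x_k - C x_k + γ_k⁻¹ u_k + γ_k⁻¹ θ S (x_k - x_{k-1}))` and
`u_{k+1} = (γ_k M_k - S) x_{k+1} - (γ_k M_k - S) x_k`. The inverse is the set-valued one and the
first update is read as a membership, i.e. `x_{k+1}` is a value of it. -/
structure IsGenerated (A : H → Set H) (C : H → H) (S : H →L[ℝ] H) (M : ℕ → H → H) (γ : ℕ → ℝ)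
    (θ : ℝ) (xm x0 u0 : H) (x u : ℕ → H) : Prop where
  x_zero : x 0 = x0
  u_zero : u 0 = u0
  x_succ : ∀ k : ℕ, x (k + 1) ∈ invOp (addOp A (M k))
    (M k (x k) - C (x k) + (γ k)⁻¹ • u k + (γ k)⁻¹ • θ • S (x k - prev xm x k))
  u_succ : ∀ k : ℕ, u (k + 1) =
    (γ k • M k (x (k + 1)) - S (x (k + 1))) - (γ k • M k (x k) - S (x k))

end

end NonlinearFB

/-! Write `γ_k M_k = S + (γ_k M_k - S)`: the method is a forward-backward step in the metric of `S`,
perturbed by a map that is Lipschitz with constant `L_k < 1`.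

Well-posedness: inverting `M_k + A` is a fixed point problem for the composition of `(S + γ_k A)⁻¹`
with an `L_k`-Lipschitz map, hence for a contraction. That `S + γ_k A` is onto is Minty's theorem
(`exists_neg_map_mem`).

Convergence rests on the Lyapunov function `energy`. Monotonicity of `A` between `x_{k+1}` and a
zero `z`, with Young's inequality for the correction, momentum and cocoercive terms, makes it drop
by at least `ε‖x_{k+1} - x_k‖_S²` (`energy_le`), while it stays above `ε` times the squared
`S`-distance to `z` (`mul_le_energy`). So increments vanish and iterates are bounded; corrections
and residuals are controlled by increments and vanish too. What survives of the energy in the limit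
is `(1 - θ)‖x_k - z‖_S²`, so the distance to every zero converges. Weak cluster points are zeros
(`mem_zer_addOp_of_tendsto`), and Opial's lemma (`exists_tendsto_inner`) concludes. -/

namespace NonlinearFB

/-! ### Scaled norms and Minty's theorem -/

section StronglyPositive

variable {H : Type*} [NormedAddCommGroup H] [InnerProductSpace ℝ H] [CompleteSpace H]
  {S : H →L[ℝ] H}

theorem IsStronglyPositive.inner_map_comm (hS : IsStronglyPositive S) (x y : H) :
    inner ℝ (S x) y = inner ℝ (S y) x := by
  rw [real_inner_comm]
  exact (hS.1.isSymmetric y x).symm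

theorem IsStronglyPositive.inner_map_self_nonneg (hS : IsStronglyPositive S) (x : H) :
    0 ≤ inner ℝ (S x) x := by
  obtain ⟨_, m, hm, h⟩ := hS
  exact le_trans (by positivity) (h x)

theorem IsStronglyPositive.eq_zero_of_inner_map_self_le (hS : IsStronglyPositive S) {x : H}
    (hx : inner ℝ (S x) x ≤ 0) : x = 0 := by
  obtain ⟨_, m, hm, h⟩ := hS
  have h1 := (h x).trans hx
  have h2 : ‖x‖ ^ 2 ≤ 0 := by
    by_contra hc
    have := mul_pos hm (not_le.mp hc)
    linarith
  exact norm_eq_zero.mp (pow_eq_zero_iff two_ne_zero |>.mp (le_antisymm h2 (sq_nonneg _)))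

theorem IsStronglyPositive.map_inverse (hS : IsStronglyPositive S) (x : H) :
    S (S.inverse x) = x :=
  hS.isInvertible.self_apply_inverse x

theorem IsStronglyPositive.inner_inverse_self_nonneg (hS : IsStronglyPositive S) (x : H) :
    0 ≤ inner ℝ (S.inverse x) x := by
  have h := hS.inner_map_self_nonneg (S.inverse x)
  rwa [hS.map_inverse, real_inner_comm] at h

theorem IsStronglyPositive.scaledNorm_sq (hS : IsStronglyPositive S) (x : H) :
    scaledNorm S x ^ 2 = inner ℝ (S x) x :=
  Real.sq_sqrt (hS.inner_map_self_nonneg x)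

theorem IsStronglyPositive.scaledNorm_inverse_sq (hS : IsStronglyPositive S) (x : H) :
    scaledNorm S.inverse x ^ 2 = inner ℝ (S.inverse x) x :=
  Real.sq_sqrt (hS.inner_inverse_self_nonneg x)

theorem scaledNorm_nonneg {H : Type*} [NormedAddCommGroup H] [InnerProductSpace ℝ H]
    (T : H →L[ℝ] H) (x : H) : 0 ≤ scaledNorm T x :=
  Real.sqrt_nonneg _

theorem scaledNorm_neg {H : Type*} [NormedAddCommGroup H] [InnerProductSpace ℝ H]
    (T : H →L[ℝ] H) (x : H) : scaledNorm T (-x) = scaledNorm T x := by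
  simp [scaledNorm]

/-- Cauchy-Schwarz inequality for the form `⟨S x, y⟩`. -/
theorem IsStronglyPositive.inner_map_sq_le (hS : IsStronglyPositive S) (x y : H) :
    inner ℝ (S x) y ^ 2 ≤ inner ℝ (S x) x * inner ℝ (S y) y := by
  have h : ∀ t : ℝ, 0 ≤ inner ℝ (S y) y * (t * t) + (2 * inner ℝ (S x) y) * t
      + inner ℝ (S x) x := by
    intro t
    have h1 := hS.inner_map_self_nonneg (x + t • y)
    have h2 := hS.inner_map_comm y x
    simp only [map_add, map_smul, inner_add_left, inner_add_right, real_inner_smul_left,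
      real_inner_smul_right] at h1
    rw [h2] at h1
    linarith
  have := discrim_le_zero h
  rw [discrim] at this
  linarith

/-- Cauchy-Schwarz inequality for the dual pair of scaled norms. -/
theorem IsStronglyPositive.abs_inner_le (hS : IsStronglyPositive S) (a b : H) :
    |inner ℝ a b| ≤ scaledNorm S.inverse a * scaledNorm S b := by
  apply abs_le_of_sq_le_sq _ (mul_nonneg (scaledNorm_nonneg _ _) (scaledNorm_nonneg _ _))
  have h := hS.inner_map_sq_le (S.inverse a) b
  rw [hS.map_inverse, real_inner_comm (S.inverse a) a] at h
  rwa [mul_pow, hS.scaledNorm_sq, hS.scaledNorm_inverse_sq]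

/-- Dual Cauchy-Schwarz followed by `2st ≤ s² + t²`; this is how the correction `u_k` is absorbed
into the energy. -/
theorem IsStronglyPositive.two_mul_abs_inner_le (hS : IsStronglyPositive S) {L : ℝ} (hL : 0 ≤ L)
    {a d : H} (h : scaledNorm S.inverse a ≤ L * scaledNorm S d) (b : H) :
    2 * |inner ℝ a b| ≤ L * (inner ℝ (S d) d + inner ℝ (S b) b) := by
  have h1 := hS.abs_inner_le a b
  have h2 := mul_le_mul_of_nonneg_right h (scaledNorm_nonneg S b)
  rw [← hS.scaledNorm_sq, ← hS.scaledNorm_sq]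
  have h3 := mul_nonneg hL (sq_nonneg (scaledNorm S d - scaledNorm S b))
  linarith

theorem IsStronglyPositive.two_mul_abs_inner_map_le (hS : IsStronglyPositive S) (a b : H) :
    2 * |inner ℝ (S a) b| ≤ inner ℝ (S a) a + inner ℝ (S b) b := by
  have h1 := hS.inner_map_self_nonneg (a + b)
  have h2 := hS.inner_map_self_nonneg (a - b)
  have h3 := hS.inner_map_comm b a
  simp only [map_add, map_sub, inner_add_left, inner_add_right, inner_sub_left,
    inner_sub_right] at h1 h2
  rw [h3] at h1 h2
  have : |inner ℝ (S a) b| ≤ (inner ℝ (S a) a + inner ℝ (S b) b) / 2 :=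
    abs_le.mpr ⟨by linarith, by linarith⟩
  linarith

theorem IsStronglyPositive.exists_norm_le (hS : IsStronglyPositive S) :
    ∃ c : ℝ, 0 < c ∧ ∀ x : H, ‖x‖ ≤ c * scaledNorm S x := by
  have hS' := hS
  obtain ⟨_, m, hm, h⟩ := hS'
  refine ⟨(√m)⁻¹, by positivity, fun x => ?_⟩
  rw [inv_mul_eq_div, le_div_iff₀ (Real.sqrt_pos.mpr hm)]
  have := Real.sqrt_le_sqrt (h x)
  rw [Real.sqrt_mul hm.le, Real.sqrt_sq (norm_nonneg x), mul_comm] at this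
  exact this

theorem IsStronglyPositive.exists_norm_le_inverse (hS : IsStronglyPositive S) :
    ∃ c : ℝ, 0 < c ∧ ∀ x : H, ‖x‖ ≤ c * scaledNorm S.inverse x := by
  obtain ⟨c, hc, h⟩ := hS.exists_norm_le
  -- The `+ 1` keeps the constant positive even if `S = 0`, which happens on the trivial space.
  refine ⟨(‖S‖ + 1) * c, by positivity, fun x => ?_⟩
  have h1 : scaledNorm S (S.inverse x) = scaledNorm S.inverse x := by
    rw [scaledNorm, scaledNorm, hS.map_inverse, real_inner_comm]
  calc ‖x‖ = ‖S (S.inverse x)‖ := by rw [hS.map_inverse]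
    _ ≤ ‖S‖ * ‖S.inverse x‖ := S.le_opNorm _
    _ ≤ (‖S‖ + 1) * (c * scaledNorm S.inverse x) := by
        have h2 := h (S.inverse x)
        rw [h1] at h2
        gcongr
        linarith
    _ = _ := by ring

theorem continuous_scaledNorm {H : Type*} [NormedAddCommGroup H] [InnerProductSpace ℝ H]
    (T : H →L[ℝ] H) : Continuous (scaledNorm T) := by
  unfold scaledNorm
  fun_prop

theorem exists_scaledNorm_le {H : Type*} [NormedAddCommGroup H] [InnerProductSpace ℝ H]
    (T : H →L[ℝ] H) : ∃ c : ℝ, 0 ≤ c ∧ ∀ x : H, scaledNorm T x ≤ c * ‖x‖ := by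
  refine ⟨√‖T‖, Real.sqrt_nonneg _, fun x => ?_⟩
  have h : inner ℝ (T x) x ≤ ‖T‖ * ‖x‖ ^ 2 := by
    have h1 := real_inner_le_norm (T x) x
    have h2 := mul_le_mul_of_nonneg_right (T.le_opNorm x) (norm_nonneg x)
    linarith
  have := Real.sqrt_le_sqrt h
  rwa [Real.sqrt_mul (norm_nonneg _), Real.sqrt_sq (norm_nonneg x)] at this

theorem cauchySeq_of_inner_map_sub_le (hS : IsStronglyPositive S) {x : ℕ → H} {b : ℕ → ℝ}
    (hb : Tendsto b atTop (𝓝 0))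
    (h : ∀ i j N, N ≤ i → N ≤ j → inner ℝ (S (x i - x j)) (x i - x j) ≤ b N) : CauchySeq x := by
  obtain ⟨c, hc, hcS⟩ := hS.exists_norm_le
  refine cauchySeq_of_le_tendsto_0 (fun N => c * √(b N)) (fun i j N hi hj => ?_) ?_
  · rw [dist_eq_norm]
    refine (hcS _).trans ?_
    exact mul_le_mul_of_nonneg_left (Real.sqrt_le_sqrt (h i j N hi hj)) hc.le
  · have := (hb.sqrt).const_mul c
    simpa using this

/-- A closed convex set on which `t + (⟨S x, x⟩ + ⟨S w, w⟩) / 2` is nonnegative contains a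
minimiser of this function. -/
theorem exists_forall_le_of_isClosed_of_convex (hS : IsStronglyPositive S) {E : Set (H × H × ℝ)}
    (hne : E.Nonempty) (hcl : IsClosed E) (hconv : Convex ℝ E)
    (h0 : ∀ z ∈ E, 0 ≤ z.2.2 + (inner ℝ (S z.1) z.1 + inner ℝ (S z.2.1) z.2.1) / 2) :
    ∃ z ∈ E, ∀ z' ∈ E, z.2.2 + (inner ℝ (S z.1) z.1 + inner ℝ (S z.2.1) z.2.1) / 2
      ≤ z'.2.2 + (inner ℝ (S z'.1) z'.1 + inner ℝ (S z'.2.1) z'.2.1) / 2 := by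
  set f : H × H × ℝ → ℝ :=
    fun z => z.2.2 + (inner ℝ (S z.1) z.1 + inner ℝ (S z.2.1) z.2.1) / 2 with hf
  set m := sInf (f '' E) with hm
  have hbdd : BddBelow (f '' E) := ⟨0, by rintro _ ⟨z, hz, rfl⟩; exact h0 z hz⟩
  have hle : ∀ z ∈ E, m ≤ f z := fun z hz => csInf_le hbdd ⟨z, hz, rfl⟩
  have hex : ∀ n : ℕ, ∃ z ∈ E, f z < m + 1 / ((n : ℝ) + 1) := by
    intro n
    obtain ⟨_, ⟨z, hz, rfl⟩, h⟩ := exists_lt_of_csInf_lt (hne.image f)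
      (show sInf (f '' E) < m + 1 / ((n : ℝ) + 1) from lt_add_of_pos_right _ (by positivity))
    exact ⟨z, hz, h⟩
  choose z hzE hzm using hex
  have hlim : Tendsto (fun n : ℕ => 1 / ((n : ℝ) + 1)) atTop (𝓝 0) :=
    tendsto_one_div_add_atTop_nhds_zero_nat
  -- Parallelogram law: at the midpoint the function lies below the average of its two values by
  -- `1/8` of the left-hand side, yet not below `m`. Minimising sequences are therefore Cauchy in
  -- the first two coordinates.
  have key : ∀ i j N : ℕ, N ≤ i → N ≤ j →
      inner ℝ (S ((z i).1 - (z j).1)) ((z i).1 - (z j).1)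
        + inner ℝ (S ((z i).2.1 - (z j).2.1)) ((z i).2.1 - (z j).2.1)
      ≤ 8 * (1 / ((N : ℝ) + 1)) := by
    intro i j N hi hj
    have hmid := hle _ (hconv (hzE i) (hzE j) (by norm_num : (0 : ℝ) ≤ 1 / 2)
      (by norm_num : (0 : ℝ) ≤ 1 / 2) (by norm_num))
    have hmono : ∀ i, N ≤ i → 1 / ((i : ℝ) + 1) ≤ 1 / ((N : ℝ) + 1) := by
      intro i hi
      exact one_div_le_one_div_of_le (by positivity) (by exact_mod_cast Nat.succ_le_succ hi)
    have h1 := (hzm i).le.trans (add_le_add_right (hmono i hi) m)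
    have h2 := (hzm j).le.trans (add_le_add_right (hmono j hj) m)
    have h3 := hS.inner_map_comm (z i).1 (z j).1
    have h4 := hS.inner_map_comm (z i).2.1 (z j).2.1
    simp only [hf, Prod.fst_add, Prod.snd_add, Prod.smul_fst, Prod.smul_snd, map_add, map_smul,
      inner_add_left, inner_add_right, real_inner_smul_left, real_inner_smul_right,
      smul_eq_mul] at hmid h1 h2
    simp only [map_sub, inner_sub_left, inner_sub_right]
    linarith
  have hx : CauchySeq fun n => (z n).1 :=
    cauchySeq_of_inner_map_sub_le hS (by simpa using hlim.const_mul 8) fun i j N hi hj =>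
      (le_add_of_nonneg_right (hS.inner_map_self_nonneg _)).trans (key i j N hi hj)
  have hw : CauchySeq fun n => (z n).2.1 :=
    cauchySeq_of_inner_map_sub_le hS (by simpa using hlim.const_mul 8) fun i j N hi hj =>
      (le_add_of_nonneg_left (hS.inner_map_self_nonneg _)).trans (key i j N hi hj)
  obtain ⟨x, hx⟩ := cauchySeq_tendsto_of_complete hx
  obtain ⟨w, hw⟩ := cauchySeq_tendsto_of_complete hw
  have hfm : Tendsto (fun n => f (z n)) atTop (𝓝 m) := by
    refine tendsto_of_tendsto_of_tendsto_of_le_of_le tendsto_const_nhds ?_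
      (fun n => hle _ (hzE n)) (fun n => (hzm n).le)
    simpa using hlim.const_add m
  have hq : ∀ {y : ℕ → H} {y' : H}, Tendsto y atTop (𝓝 y') →
      Tendsto (fun n => inner ℝ (S (y n)) (y n)) atTop (𝓝 (inner ℝ (S y') y')) :=
    fun h => ((S.continuous.tendsto _).comp h).inner h
  -- The third coordinate converges because the total value and both quadratic terms do.
  have ht : Tendsto (fun n => (z n).2.2) atTop
      (𝓝 (m - (inner ℝ (S x) x + inner ℝ (S w) w) / 2)) := by
    refine (hfm.sub (((hq hx).add (hq hw)).div_const 2)).congr fun n => ?_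
    simp only [hf]
    ring
  refine ⟨(x, w, m - (inner ℝ (S x) x + inner ℝ (S w) w) / 2),
    hcl.mem_of_tendsto (hx.prodMk_nhds (hw.prodMk_nhds ht)) (Eventually.of_forall hzE), ?_⟩
  intro z' hz'
  have := hle z' hz'
  simp only [hf] at this
  linarith

/-- Minty's theorem: if `G` is a maximally monotone set, then `0` is a value of `S + G`. The proof
minimises the sum of the Fitzpatrick function of `G` and a quadratic form. -/
theorem IsStronglyPositive.exists_neg_map_mem (hS : IsStronglyPositive S) {G : Set (H × H)}
    (hmono : ∀ p ∈ G, ∀ q ∈ G, (0 : ℝ) ≤ inner ℝ (p.2 - q.2) (p.1 - q.1))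
    (hmax : ∀ x u : H, (∀ q ∈ G, (0 : ℝ) ≤ inner ℝ (u - q.2) (x - q.1)) → (x, u) ∈ G) :
    ∃ x, (x, -S x) ∈ G := by
  -- Epigraph of the Fitzpatrick function of `G`, with dual variable written as `S w` so that both
  -- quadratic terms use the form of `S`.
  set E : Set (H × H × ℝ) := {z | ∀ q ∈ G,
    inner ℝ z.1 q.2 + inner ℝ q.1 (S z.2.1) - inner ℝ q.1 q.2 ≤ z.2.2} with hE
  have hGne : G.Nonempty := by
    by_contra hc
    rw [Set.not_nonempty_iff_eq_empty] at hc
    have := hmax 0 0 (by simp [hc])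
    simp [hc] at this
  have hGE : ∀ q ∈ G, (q.1, S.inverse q.2, (inner ℝ q.1 q.2 : ℝ)) ∈ E := by
    intro p hp q hq
    have h := hmono p hp q hq
    simp only [inner_sub_left, inner_sub_right] at h
    simp only [hS.map_inverse]
    rw [real_inner_comm q.2 p.1, real_inner_comm p.2 q.1, real_inner_comm q.2 q.1,
      real_inner_comm p.2 p.1]
    linarith
  -- The Fitzpatrick function dominates the duality pairing: either `(z.1, S z.2.1)` belongs to `G`
  -- by maximality and can itself be used as `q`, or some `q` violates monotonicity, which gives the
  -- bound directly.
  have hlow : ∀ z ∈ E, inner ℝ (S z.2.1) z.1 ≤ z.2.2 := by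
    intro z hz
    by_cases h : ∀ q ∈ G, (0 : ℝ) ≤ inner ℝ (S z.2.1 - q.2) (z.1 - q.1)
    · have := hz _ (hmax _ _ h)
      rw [real_inner_comm]
      linarith
    · push Not at h
      obtain ⟨q, hq, h⟩ := h
      have h1 := hz q hq
      simp only [inner_sub_left, inner_sub_right] at h
      rw [real_inner_comm q.2 z.1, real_inner_comm (S z.2.1) q.1, real_inner_comm q.2 q.1] at h1
      linarith
  have hcl : IsClosed E := by
    simp only [hE, Set.ofPred_forall]
    refine isClosed_iInter fun q => isClosed_iInter fun _ => isClosed_le ?_ ?_ <;> fun_prop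
  have hconv : Convex ℝ E := by
    intro z hz z' hz' a b ha hb hab q hq
    have h1 := mul_le_mul_of_nonneg_left (hz q hq) ha
    have h2 := mul_le_mul_of_nonneg_left (hz' q hq) hb
    obtain rfl : b = 1 - a := by linarith
    simp only [Prod.fst_add, Prod.snd_add, Prod.smul_fst, Prod.smul_snd, map_add, map_smul,
      inner_add_left, inner_add_right, real_inner_smul_left, real_inner_smul_right, smul_eq_mul]
    linarith
  have hpos : ∀ z ∈ E, 0 ≤ z.2.2 + (inner ℝ (S z.1) z.1 + inner ℝ (S z.2.1) z.2.1) / 2 := by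
    intro z hz
    have h1 := hlow z hz
    have h2 := hS.two_mul_abs_inner_map_le z.2.1 z.1
    have h3 := neg_abs_le (inner ℝ (S z.2.1) z.1)
    linarith
  obtain ⟨q₀, hq₀⟩ := hGne
  obtain ⟨⟨x, w, t⟩, hzE, hmin⟩ :=
    exists_forall_le_of_isClosed_of_convex hS ⟨_, hGE q₀ hq₀⟩ hcl hconv hpos
  -- First-order optimality: compare with the point at parameter `s` on the segment towards `z`,
  -- divide by `s` and let `s → 0`.
  have hopt : ∀ z ∈ E, 0 ≤ z.2.2 - t + inner ℝ (S x) (z.1 - x) + inner ℝ (S w) (z.2.1 - w) := by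
    intro z hz
    set r := (inner ℝ (S (z.1 - x)) (z.1 - x) + inner ℝ (S (z.2.1 - w)) (z.2.1 - w)) / 2 with hr
    have hs : ∀ s : ℝ, 0 < s → s ≤ 1 →
        0 ≤ z.2.2 - t + inner ℝ (S x) (z.1 - x) + inner ℝ (S w) (z.2.1 - w) + s * r := by
      intro s hs0 hs1
      have h := hmin _ (hconv hzE hz (sub_nonneg.mpr hs1) hs0.le (by ring))
      have h3 := hS.inner_map_comm x z.1
      have h4 := hS.inner_map_comm w z.2.1
      simp only [Prod.fst_add, Prod.snd_add, Prod.smul_fst, Prod.smul_snd, map_add, map_smul,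
        inner_add_left, inner_add_right, real_inner_smul_left, real_inner_smul_right,
        smul_eq_mul] at h
      refine (mul_nonneg_iff_of_pos_left hs0).mp ?_
      simp only [hr, map_sub, inner_sub_left, inner_sub_right]
      rw [← h3, ← h4] at h ⊢
      linarith
    have hlim : Tendsto (fun s : ℝ =>
        z.2.2 - t + inner ℝ (S x) (z.1 - x) + inner ℝ (S w) (z.2.1 - w) + s * r) (𝓝[>] 0)
        (𝓝 (z.2.2 - t + inner ℝ (S x) (z.1 - x) + inner ℝ (S w) (z.2.1 - w) + 0 * r)) :=
      (Continuous.tendsto (by fun_prop) 0).mono_left nhdsWithin_le_nhds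
    rw [zero_mul, add_zero] at hlim
    refine ge_of_tendsto hlim ?_
    filter_upwards [Ioc_mem_nhdsGT (zero_lt_one' ℝ)] with s hs'
    exact hs s hs'.1 hs'.2
  -- Optimality tested at the points of `E` coming from `G`, combined with `t ≥ ⟨S w, x⟩`. Hence
  -- `(-w, -S x)` is monotonically related to `G`, so it lies in `G`; taking it as `q` then forces
  -- `w = -x`.
  have hrel : ∀ q ∈ G, inner ℝ (S (x + w)) (x + w) ≤ inner ℝ (-S x - q.2) (-w - q.1) := by
    intro q hq
    have h1 := hopt _ (hGE q hq)
    have h2 := hlow _ hzE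
    have h3 := hS.inner_map_comm x w
    have h4 := hS.inner_map_comm w (S.inverse q.2)
    rw [hS.map_inverse] at h4
    simp only [inner_sub_right] at h1
    simp only [map_add, inner_add_left, inner_add_right, inner_sub_left, inner_sub_right,
      inner_neg_left, inner_neg_right]
    rw [real_inner_comm q.2 q.1] at h1
    simp only at h2
    linarith
  have hmem := hmax (-w) (-S x) fun q hq => (hS.inner_map_self_nonneg _).trans (hrel q hq)
  have h := hrel _ hmem
  simp only [sub_self, inner_zero_left] at h
  have hxw := hS.eq_zero_of_inner_map_self_le h
  refine ⟨x, ?_⟩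
  rwa [eq_neg_of_add_eq_zero_left hxw, ← eq_neg_of_add_eq_zero_left hxw] at hmem

end StronglyPositive

/-! ### Resolvents and well-posedness of the iteration -/

section Resolvent

theorem mem_addOp_iff {H : Type*} [NormedAddCommGroup H] {A : H → Set H} {T : H → H} {x z : H} :
    z ∈ addOp A T x ↔ z - T x ∈ A x := by
  simp only [addOp, Set.add_singleton, Set.mem_image]
  constructor
  · rintro ⟨a, ha, rfl⟩
    simpa using ha
  · intro h
    exact ⟨_, h, sub_add_cancel _ _⟩

theorem mem_invOp_addOp_iff {H : Type*} [NormedAddCommGroup H] {A : H → Set H} {T : H → H} {x z : H} :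
    x ∈ invOp (addOp A T) z ↔ z - T x ∈ A x :=
  mem_addOp_iff

variable {H : Type*} [NormedAddCommGroup H] [InnerProductSpace ℝ H]

/-- Otherwise adjoining `(x, u)` to the graph would give a proper monotone extension. -/
theorem IsMaximallyMonotone.mem_of_forall {A : H → Set H} (hA : IsMaximallyMonotone A) {x u : H}
    (h : ∀ y, ∀ v ∈ A y, (0 : ℝ) ≤ inner ℝ (u - v) (x - y)) : u ∈ A x := by
  by_contra hu
  refine hA.2 (fun y => A y ∪ {v | y = x ∧ v = u}) ?_ ⟨fun p hp => Or.inl hp, fun hsub => hu ?_⟩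
  · rintro ⟨y, v⟩ hp ⟨y', v'⟩ hq
    rcases hp with hp | ⟨hy, hv⟩ <;> rcases hq with hq | ⟨hy', hv'⟩
    · exact hA.1 _ hp _ hq
    · simp only at hy' hv' ⊢
      have := h y v hp
      rw [hy', hv', ← neg_sub u v, ← neg_sub x y, inner_neg_neg]
      exact this
    · simp only at hy hv ⊢
      rw [hy, hv]
      exact h y' v' hq
    · simp only at hy hv hy' hv' ⊢
      simp [hy, hv, hy', hv']
  · exact hsub (show (x, u) ∈ gra _ from Or.inr ⟨rfl, rfl⟩)

variable [CompleteSpace H] {S : H →L[ℝ] H}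

/-- The operator `S + γ A` is surjective. -/
theorem IsStronglyPositive.exists_inv_smul_sub_mem (hS : IsStronglyPositive S) {A : H → Set H}
    (hA : IsMaximallyMonotone A) {γ : ℝ} (hγ : 0 < γ) (z : H) :
    ∃ x, γ⁻¹ • (z - S x) ∈ A x := by
  -- The set is the graph of `γ A - z`, which inherits maximal monotonicity from `A`.
  suffices h : ∃ x, (x, -S x) ∈ {p : H × H | γ⁻¹ • (p.2 + z) ∈ A p.1} by
    simpa [sub_eq_neg_add] using h
  refine hS.exists_neg_map_mem ?_ ?_
  · intro p hp q hq
    have h := hA.1 (p.1, γ⁻¹ • (p.2 + z)) hp (q.1, γ⁻¹ • (q.2 + z)) hq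
    simp only [← smul_sub, add_sub_add_right_eq_sub, real_inner_smul_left] at h
    exact (mul_nonneg_iff_of_pos_left (inv_pos.mpr hγ)).mp h
  · intro x u h
    refine hA.mem_of_forall fun y v hv => ?_
    have h1 := h (y, γ • v - z) (by
      rwa [Set.mem_ofPred_eq, sub_add_cancel, smul_smul, inv_mul_cancel₀ hγ.ne', one_smul])
    have h2 : γ⁻¹ • (u + z) - v = γ⁻¹ • (u - (γ • v - z)) := by
      rw [show u - (γ • v - z) = (u + z) - γ • v by abel, smul_sub γ⁻¹ (u + z), smul_smul,
        inv_mul_cancel₀ hγ.ne', one_smul]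
    rw [h2, real_inner_smul_left]
    exact mul_nonneg (inv_pos.mpr hγ).le h1

/-- Banach's fixed point theorem for the norm `scaledNorm S`. -/
theorem IsStronglyPositive.exists_fixedPoint (hS : IsStronglyPositive S) {T : H → H} {L : ℝ}
    (hL : 0 ≤ L) (hL1 : L < 1)
    (hT : ∀ x y, scaledNorm S (T x - T y) ≤ L * scaledNorm S (x - y)) : ∃ x, T x = x := by
  obtain ⟨c, hc, hcS⟩ := hS.exists_norm_le
  obtain ⟨c', hc', hcS'⟩ := exists_scaledNorm_le S
  set x : ℕ → H := fun n => T^[n] 0 with hx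
  have hsucc : ∀ n, x (n + 1) = T (x n) := fun n => Function.iterate_succ_apply' T n 0
  have hgeo : ∀ n, scaledNorm S (x n - x (n + 1)) ≤ scaledNorm S (x 0 - x 1) * L ^ n := by
    intro n
    induction n with
    | zero => simp
    | succ n ih =>
      rw [hsucc (n + 1), hsucc n]
      refine (hT _ _).trans ?_
      rw [← hsucc n, pow_succ']
      have := mul_le_mul_of_nonneg_left ih hL
      linarith
  have hcau : CauchySeq x :=
    cauchySeq_of_le_geometric L (c * scaledNorm S (x 0 - x 1)) hL1 fun n => by
      rw [dist_eq_norm, mul_assoc]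
      exact (hcS _).trans (mul_le_mul_of_nonneg_left (hgeo n) hc.le)
  obtain ⟨y, hy⟩ := cauchySeq_tendsto_of_complete hcau
  refine ⟨y, tendsto_nhds_unique (f := fun n => x (n + 1)) (l := atTop) ?_
    (hy.comp (tendsto_add_atTop_nat 1))⟩
  simp only [hsucc]
  rw [tendsto_iff_norm_sub_tendsto_zero] at hy ⊢
  have hlim := hy.const_mul (c * (L * c'))
  rw [mul_zero] at hlim
  refine squeeze_zero (fun _ => norm_nonneg _) (fun n => ?_) hlim
  calc ‖T (x n) - T y‖ ≤ c * scaledNorm S (T (x n) - T y) := hcS _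
    _ ≤ c * (L * (c' * ‖x n - y‖)) :=
        mul_le_mul_of_nonneg_left ((hT _ _).trans (mul_le_mul_of_nonneg_left (hcS' _) hL)) hc.le
    _ = _ := by ring

/-- If `γ M - S` is Lipschitz continuous with constant less than `1`, then `(M + A)⁻¹` is
single-valued with full domain. -/
theorem IsStronglyPositive.existsUnique_mem_invOp (hS : IsStronglyPositive S) {A : H → Set H}
    (hA : IsMaximallyMonotone A) {M : H → H} {γ L : ℝ} (hγ : 0 < γ) (hL1 : L < 1)
    (hM : IsLipschitzWrt S L (fun x => γ • M x - S x)) (z : H) :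
    ∃! x, x ∈ invOp (addOp A M) z := by
  obtain ⟨hL, hM⟩ := hM
  simp only [mem_invOp_addOp_iff]
  refine existsUnique_of_exists_of_unique ?_ ?_
  · choose J hJ using hS.exists_inv_smul_sub_mem hA hγ
    -- With dual Cauchy-Schwarz this makes `J = (S + γ A)⁻¹` nonexpansive from the `S⁻¹`-norm to the
    -- `S`-norm.
    have hJle : ∀ p q, inner ℝ (S (J p - J q)) (J p - J q) ≤ inner ℝ (p - q) (J p - J q) := by
      intro p q
      have h := hA.1 (J p, _) (hJ p) (J q, _) (hJ q)
      simp only [← smul_sub, real_inner_smul_left] at h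
      have h1 := (mul_nonneg_iff_of_pos_left (inv_pos.mpr hγ)).mp h
      rw [show p - S (J p) - (q - S (J q)) = (p - q) - S (J p - J q) by rw [map_sub]; abel,
        inner_sub_left] at h1
      linarith
    obtain ⟨x, hx⟩ := hS.exists_fixedPoint (T := fun x => J (γ • z - (γ • M x - S x))) hL hL1 (by
      intro x y
      set d := J (γ • z - (γ • M x - S x)) - J (γ • z - (γ • M y - S y)) with hd
      have h := hJle (γ • z - (γ • M x - S x)) (γ • z - (γ • M y - S y))
      rw [← hd, ← hS.scaledNorm_sq, sub_sub_sub_cancel_left] at h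
      have h1 := (le_abs_self _).trans (hS.abs_inner_le
        ((γ • M y - S y) - (γ • M x - S x)) d)
      have h2 := hM x y
      rw [← scaledNorm_neg, neg_sub] at h2
      have h3 := mul_le_mul_of_nonneg_right h2 (scaledNorm_nonneg S d)
      rcases (scaledNorm_nonneg S d).eq_or_lt with h0 | h0
      · rw [← h0]
        exact mul_nonneg hL (scaledNorm_nonneg _ _)
      · refine le_of_mul_le_mul_right ?_ h0
        rw [← sq]
        exact h.trans (h1.trans h3))
    refine ⟨x, ?_⟩
    have h := hJ (γ • z - (γ • M x - S x))
    rw [hx, show γ • z - (γ • M x - S x) - S x = γ • (z - M x) by rw [smul_sub]; abel, smul_smul,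
      inv_mul_cancel₀ hγ.ne', one_smul] at h
    exact h
  · intro x y hx hy
    have h := hA.1 (x, _) hx (y, _) hy
    simp only [sub_sub_sub_cancel_left] at h
    have h1 := mul_nonneg hγ.le h
    rw [← real_inner_smul_left] at h1
    have h2 := (le_abs_self _).trans
      (hS.abs_inner_le ((γ • M y - S y) - (γ • M x - S x)) (x - y))
    have h3 := hM x y
    rw [← scaledNorm_neg, neg_sub] at h3
    have h4 := mul_le_mul_of_nonneg_right h3 (scaledNorm_nonneg S (x - y))
    rw [show γ • (M y - M x) = (γ • M y - S y) - (γ • M x - S x) - S (x - y) by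
      rw [smul_sub, map_sub]; abel, inner_sub_left] at h1
    have h5 := hS.scaledNorm_sq (x - y)
    have h6 : scaledNorm S (x - y) ^ 2 ≤ 0 := by
      by_contra hc
      have := mul_pos (sub_pos.mpr hL1) (not_le.mp hc)
      linarith
    exact sub_eq_zero.mp (hS.eq_zero_of_inner_map_self_le (h5 ▸ h6))

theorem existsUnique_isGenerated {H : Type*} [NormedAddCommGroup H] [InnerProductSpace ℝ H]
    {A : H → Set H} {C : H → H} {S : H →L[ℝ] H} {M : ℕ → H → H} {γ : ℕ → ℝ} {θ : ℝ}
    (hres : ∀ k z, ∃! x, x ∈ invOp (addOp A (M k)) z) (xm x0 u0 : H) :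
    ∃! p : (ℕ → H) × (ℕ → H), IsGenerated A C S M γ θ xm x0 u0 p.1 p.2 := by
  refine existsUnique_of_exists_of_unique ?_ ?_
  · choose R hR using fun k z => (hres k z).exists
    let next : ℕ → H × H × H → H := fun k s =>
      R k (M k s.2.1 - C s.2.1 + (γ k)⁻¹ • s.2.2 + (γ k)⁻¹ • θ • S (s.2.1 - s.1))
    -- The state at time `k` is the triple `(x_{k-1}, x_k, u_k)`, which turns the two-step recursion
    -- into a one-step one.
    let st : ℕ → H × H × H := fun k => Nat.rec (xm, x0, u0) (fun k s =>
      (s.2.1, next k s, (γ k • M k (next k s) - S (next k s)) - (γ k • M k s.2.1 - S s.2.1))) k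
    have hprev : ∀ k, prev xm (fun k => (st k).2.1) k = (st k).1 := by
      intro k
      cases k <;> rfl
    refine ⟨(fun k => (st k).2.1, fun k => (st k).2.2), rfl, rfl, fun k => ?_, fun k => rfl⟩
    simp only [hprev]
    exact hR k _
  · rintro ⟨x, u⟩ ⟨y, v⟩ h h'
    have key : ∀ k, prev xm x k = prev xm y k ∧ x k = y k ∧ u k = v k := by
      intro k
      induction k with
      | zero => exact ⟨rfl, h.x_zero.trans h'.x_zero.symm, h.u_zero.trans h'.u_zero.symm⟩
      | succ k ih =>
        obtain ⟨h1, h2, h3⟩ := ih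
        have h4 : x (k + 1) = y (k + 1) := by
          refine (hres k _).unique (h.x_succ k) ?_
          have := h'.x_succ k
          simp only at this ⊢
          rwa [← h1, ← h2, ← h3] at this
        refine ⟨h2, h4, (h.u_succ k).trans ?_⟩
        simp only [h2, h4]
        exact (h'.u_succ k).symm
    exact Prod.ext (funext fun k => (key k).2.1) (funext fun k => (key k).2.2)

end Resolvent

/-! ### Weak convergence, Opial's lemma and demiclosedness -/

section WeakConvergence

variable {H : Type*} [NormedAddCommGroup H] [InnerProductSpace ℝ H] {ι : Type*} {l : Filter ι}

theorem tendsto_inner_zero_of_norm_le {a b : ι → H} (ha : Tendsto a l (𝓝 0)) {R : ℝ}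
    (hb : ∀ i, ‖b i‖ ≤ R) : Tendsto (fun i => (inner ℝ (a i) (b i) : ℝ)) l (𝓝 0) := by
  have h := ha.norm.mul_const R
  rw [norm_zero, zero_mul] at h
  refine squeeze_zero_norm (fun i => ?_) h
  exact (norm_inner_le_norm _ _).trans (mul_le_mul_of_nonneg_left (hb i) (norm_nonneg _))

theorem tendsto_inner_of_forall_tendsto_inner {a b : ι → H} {a' b' : H}
    (ha : Tendsto a l (𝓝 a')) {R : ℝ} (hbR : ∀ i, ‖b i‖ ≤ R)
    (hb : ∀ y, Tendsto (fun i => (inner ℝ (b i) y : ℝ)) l (𝓝 (inner ℝ b' y))) :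
    Tendsto (fun i => (inner ℝ (a i) (b i) : ℝ)) l (𝓝 (inner ℝ a' b')) := by
  have h := (tendsto_inner_zero_of_norm_le (tendsto_sub_nhds_zero_iff.mpr ha) hbR).add (hb a')
  rw [zero_add, real_inner_comm] at h
  refine h.congr fun i => ?_
  rw [inner_sub_left, real_inner_comm a' (b i)]
  ring

theorem tendsto_toWeakSpace_of_inner [CompleteSpace H] {x : ι → H} {p : H}
    (h : ∀ y, Tendsto (fun i => (inner ℝ (x i) y : ℝ)) l (𝓝 (inner ℝ p y))) :
    Tendsto (fun i => toWeakSpace ℝ H (x i)) l (𝓝 (toWeakSpace ℝ H p)) := by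
  refine (WeakBilin.tendsto_iff_forall_eval_tendsto (topDualPairing ℝ H).flip ?_).mpr fun f => ?_
  · intro y z hyz
    refine ext_inner_left ℝ fun v => ?_
    exact DFunLike.congr_fun hyz (InnerProductSpace.toDual ℝ H v)
  · obtain ⟨y, rfl⟩ := (InnerProductSpace.toDual ℝ H).surjective f
    have := h y
    simp only [real_inner_comm y] at this
    exact this

/-- Banach-Alaoglu transported through the Riesz isometry. Ultrafilters replace weakly convergent
subsequences. -/
theorem exists_forall_tendsto_inner_ultrafilter [CompleteSpace H] {x : ι → H} {R : ℝ}
    (hx : ∀ i, ‖x i‖ ≤ R) (U : Ultrafilter ι) :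
    ∃ p, ∀ y, Tendsto (fun i => (inner ℝ (x i) y : ℝ)) U (𝓝 (inner ℝ p y)) := by
  let f : ι → WeakDual ℝ H := fun i =>
    StrongDual.toWeakDual (InnerProductSpace.toDual ℝ H (x i))
  have hmem : ∀ i, f i ∈ WeakDual.toStrongDual ⁻¹' Metric.closedBall (0 : StrongDual ℝ H) R := by
    intro i
    rw [Set.mem_preimage, mem_closedBall_zero_iff]
    exact ((InnerProductSpace.toDual ℝ H).norm_map (x i)).trans_le (hx i)
  obtain ⟨φ, -, hφ⟩ := (WeakDual.isCompact_closedBall (0 : StrongDual ℝ H) R).ultrafilter_le_nhds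
    (U.map f) (tendsto_principal.mpr (Eventually.of_forall hmem))
  obtain ⟨p, hp⟩ := (InnerProductSpace.toDual ℝ H).surjective (WeakDual.toStrongDual φ)
  refine ⟨p, fun y => ?_⟩
  have h := ((WeakDual.eval_continuous y).tendsto φ).comp (show Tendsto f U (𝓝 φ) from hφ)
  have h1 : φ y = inner ℝ p y := by
    rw [← WeakDual.toStrongDual_apply, ← hp]
    rfl
  rw [h1] at h
  exact h

/-- Opial's lemma for the norm `scaledNorm S`. -/
theorem IsStronglyPositive.exists_tendsto_inner [CompleteSpace H] {S : H →L[ℝ] H}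
    (hS : IsStronglyPositive S) [l.NeBot] {x : ι → H} {Z : Set H} {R : ℝ} (hx : ∀ i, ‖x i‖ ≤ R)
    (hlim : ∀ z ∈ Z, ∃ r : ℝ, Tendsto (fun i => inner ℝ (S (x i - z)) (x i - z)) l (𝓝 r))
    (hcl : ∀ U : Ultrafilter ι, ↑U ≤ l → ∀ p,
      (∀ y, Tendsto (fun i => (inner ℝ (x i) y : ℝ)) U (𝓝 (inner ℝ p y))) → p ∈ Z) :
    ∃ p ∈ Z, ∀ y, Tendsto (fun i => (inner ℝ (x i) y : ℝ)) l (𝓝 (inner ℝ p y)) := by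
  obtain ⟨p, hp⟩ := exists_forall_tendsto_inner_ultrafilter hx (Ultrafilter.of l)
  have hpZ := hcl _ (Ultrafilter.of_le l) p hp
  refine ⟨p, hpZ, fun y => tendsto_iff_ultrafilter _ _ _ |>.mpr fun U hU => ?_⟩
  obtain ⟨q, hq⟩ := exists_forall_tendsto_inner_ultrafilter hx U
  have hqZ := hcl U hU q hq
  obtain ⟨r, hr⟩ := hlim p hpZ
  obtain ⟨s, hs⟩ := hlim q hqZ
  -- The difference of the squared distances to `q` and `p` is affine in `x i`, so its linear part
  -- converges along all of `l` and cannot distinguish two cluster points.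
  have hdiff : Tendsto (fun i => (inner ℝ (x i) (S (p - q)) : ℝ)) l
      (𝓝 ((s - r + inner ℝ (S p) p - inner ℝ (S q) q) / 2)) := by
    refine ((((hs.sub hr).add_const _).sub_const _).div_const 2).congr fun i => ?_
    rw [real_inner_comm (S (p - q)) (x i)]
    have h1 := hS.inner_map_comm p (x i)
    have h2 := hS.inner_map_comm q (x i)
    simp only [map_sub, inner_sub_left, inner_sub_right]
    linarith
  have h1 := tendsto_nhds_unique (hp (S (p - q))) (hdiff.mono_left (Ultrafilter.of_le l))
  have h2 := tendsto_nhds_unique (hq (S (p - q))) (hdiff.mono_left hU)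
  have h3 : p = q := by
    refine sub_eq_zero.mp (hS.eq_zero_of_inner_map_self_le ?_)
    rw [real_inner_comm (p - q), inner_sub_left, h1, h2, sub_self]
  subst h3
  exact hq y

/-- The graph of `A + C` is closed in the weak-strong topology along bounded nets. -/
theorem mem_zer_addOp_of_tendsto {A : H → Set H} {C : H → H} (hA : IsMaximallyMonotone A)
    [l.NeBot] {κ : ℝ} (hκ : 0 < κ)
    (hC : ∀ x y, κ * ‖C x - C y‖ ^ 2 ≤ inner ℝ (C x - C y) (x - y))
    {y g : ι → H} {p z : H} {R : ℝ} (hz : z ∈ zer (addOp A C)) (hR : ∀ i, ‖y i‖ ≤ R)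
    (hy : ∀ v, Tendsto (fun i => (inner ℝ (y i) v : ℝ)) l (𝓝 (inner ℝ p v)))
    (hg : ∀ i, g i ∈ addOp A C (y i)) (hg0 : Tendsto g l (𝓝 0)) : p ∈ zer (addOp A C) := by
  have hgA : ∀ i, g i - C (y i) ∈ A (y i) := fun i => mem_addOp_iff.mp (hg i)
  have hzA : 0 - C z ∈ A z := mem_addOp_iff.mp hz
  have hbd : ∀ w i, ‖y i - w‖ ≤ R + ‖w‖ := fun w i =>
    (norm_sub_le _ _).trans (add_le_add_left (hR i) _)
  have hyw : ∀ w v, Tendsto (fun i => (inner ℝ (y i - w) v : ℝ)) l (𝓝 (inner ℝ (p - w) v)) := by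
    intro w v
    simp only [inner_sub_left]
    exact (hy v).sub_const _
  have hstrong : ∀ w, Tendsto (fun i => (inner ℝ (C (y i) - C w) (y i - w) : ℝ)) l (𝓝 0) →
      Tendsto (fun i => C (y i)) l (𝓝 (C w)) := by
    intro w hw
    rw [← tendsto_sub_nhds_zero_iff, tendsto_zero_iff_norm_tendsto_zero]
    have h1 : Tendsto (fun i => ‖C (y i) - C w‖ ^ 2) l (𝓝 0) := by
      have h2 := hw.const_mul κ⁻¹
      rw [mul_zero] at h2
      refine squeeze_zero (fun i => sq_nonneg _) (fun i => ?_) h2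
      rw [inv_mul_eq_div, le_div_iff₀ hκ, mul_comm]
      exact hC _ _
    have h3 := h1.sqrt
    simpa [Real.sqrt_sq (norm_nonneg _)] using h3
  -- Monotonicity of `A` against the known zero `z` bounds `⟨C y_i - C z, y_i - z⟩` by `⟨g_i, y_i -
  -- z⟩`, which tends to `0`; cocoercivity upgrades this to strong convergence.
  have hCz : Tendsto (fun i => C (y i)) l (𝓝 (C z)) := by
    refine hstrong z (squeeze_zero (fun i => ?_) (fun i => ?_)
      (tendsto_inner_zero_of_norm_le hg0 (hbd z)))
    · exact (mul_nonneg hκ.le (sq_nonneg _)).trans (hC _ _)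
    · have h := hA.1 (y i, _) (hgA i) (z, _) hzA
      rw [show g i - C (y i) - (0 - C z) = g i - (C (y i) - C z) by abel, inner_sub_left] at h
      linarith
  -- Now `C y_i` converges strongly and `y_i - p` weakly to `0`, so the same cocoercivity argument
  -- at `p` yields a second limit.
  have hCp : C p = C z := by
    refine tendsto_nhds_unique (hstrong p ?_) hCz
    have := tendsto_inner_of_forall_tendsto_inner (hCz.sub_const (C p)) (hbd p) (hyw p)
    simpa using this
  refine mem_addOp_iff.mpr (hA.mem_of_forall fun w v hv => ?_)
  have hlim := tendsto_inner_of_forall_tendsto_inner ((hg0.sub hCz).sub_const v) (hbd w) (hyw w)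
  rw [hCp]
  exact ge_of_tendsto' hlim fun i => hA.1 (y i, _) (hgA i) (w, v) hv

end WeakConvergence

/-! ### Consequences of cocoercivity -/

section Cocoercive

variable {H : Type*} [NormedAddCommGroup H] [InnerProductSpace ℝ H] [CompleteSpace H]
  {S : H →L[ℝ] H} {C : H → H} {ℓ : ℝ}

theorem IsStronglyPositive.exists_norm_cocoercive (hS : IsStronglyPositive S)
    (hC : (0 < ℓ ∧ IsCocoerciveWrt S ℓ⁻¹ C) ∨ (C = 0 ∧ ℓ = 0)) :
    ∃ κ : ℝ, 0 < κ ∧ ∀ x y, κ * ‖C x - C y‖ ^ 2 ≤ inner ℝ (C x - C y) (x - y) := by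
  rcases hC with ⟨hℓ, hC⟩ | ⟨rfl, -⟩
  · obtain ⟨c, hc, hcS⟩ := hS.exists_norm_le_inverse
    refine ⟨ℓ⁻¹ * (c ^ 2)⁻¹, by positivity, fun x y => le_trans ?_ (hC x y)⟩
    rw [mul_assoc]
    refine mul_le_mul_of_nonneg_left ?_ (inv_pos.mpr hℓ).le
    rw [inv_mul_eq_div, div_le_iff₀ (by positivity), mul_comm, ← mul_pow]
    exact pow_le_pow_left₀ (norm_nonneg _) (hcS _) 2
  · exact ⟨1, one_pos, by simp⟩

theorem IsStronglyPositive.neg_two_mul_inner_le (hS : IsStronglyPositive S)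
    (hC : (0 < ℓ ∧ IsCocoerciveWrt S ℓ⁻¹ C) ∨ (C = 0 ∧ ℓ = 0)) (x y z : H) :
    -(2 * inner ℝ (C x - C z) (y - z)) ≤ ℓ / 2 * inner ℝ (S (y - x)) (y - x) := by
  rcases hC with ⟨hℓ, hC⟩ | ⟨rfl, rfl⟩
  · have h1 := hC x z
    have h2 := (neg_le_abs _).trans (hS.abs_inner_le (C x - C z) (y - x))
    rw [← hS.scaledNorm_sq]
    set n := scaledNorm S.inverse (C x - C z)
    set s := scaledNorm S (y - x)
    -- Young's inequality with the weight that uses up exactly the cocoercive gain `2 ℓ⁻¹ n²` and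
    -- leaves `(ℓ/2) s²`.
    have h3 : 0 ≤ ℓ⁻¹ * (2 * n - ℓ * s) ^ 2 := by positivity
    have h4 : ℓ⁻¹ * (2 * n - ℓ * s) ^ 2 = 4 * (ℓ⁻¹ * n ^ 2) - 4 * (n * s) + ℓ * s ^ 2 := by
      field_simp
      ring
    rw [← sub_add_sub_cancel y x z, inner_add_right]
    linarith
  · simp

end Cocoercive

/-! ### The Lyapunov inequality -/

section Energy

variable {H : Type*} [NormedAddCommGroup H] [InnerProductSpace ℝ H] [CompleteSpace H]
  {S : H →L[ℝ] H}

/-- The Lyapunov function of the method at consecutive iterates `a`, `b` and correction `u`. -/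
noncomputable def energy (S : H →L[ℝ] H) (θ L : ℝ) (z a b u : H) : ℝ :=
  inner ℝ (S (b - z)) (b - z) + 2 * inner ℝ u (b - z) - θ * inner ℝ (S (a - z)) (a - z)
    + (θ + |θ| + L) * inner ℝ (S (b - a)) (b - a)

/-- Young's inequality on `2⟨u, b - z⟩` costs `L` of each square. For `θ ≤ 0` the `a`-term is
nonnegative; for `θ ≥ 0` the parallelogram bound `hpar` trades it for `b`-terms, and the coefficient
`θ + |θ| = 2θ` pays for the extra `‖b - a‖_S²`. -/
theorem IsStronglyPositive.mul_le_energy (hS : IsStronglyPositive S) {θ L ε : ℝ} (hL : 0 ≤ L)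
    (hε : ε ≤ 1 - θ - 2 * |θ| - L) {z a b u : H}
    (hu : scaledNorm S.inverse u ≤ L * scaledNorm S (b - a)) :
    ε * inner ℝ (S (b - z)) (b - z) ≤ energy S θ L z a b u := by
  have h1 := hS.two_mul_abs_inner_le hL hu (b - z)
  have h2 := neg_abs_le (inner ℝ u (b - z))
  have he := hS.inner_map_self_nonneg (b - z)
  have ha := hS.inner_map_self_nonneg (a - z)
  have hd := hS.inner_map_self_nonneg (b - a)
  have h3 := mul_le_mul_of_nonneg_right hε he
  have hpar : inner ℝ (S (a - z)) (a - z)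
      ≤ 2 * inner ℝ (S (b - z)) (b - z) + 2 * inner ℝ (S (b - a)) (b - a) := by
    have h4 := hS.inner_map_self_nonneg ((b - z) + (b - a))
    rw [show a - z = (b - z) - (b - a) by abel]
    generalize b - z = e at *
    generalize b - a = d at *
    simp only [map_add, map_sub, inner_add_left, inner_add_right, inner_sub_left,
      inner_sub_right] at *
    linarith
  unfold energy
  rcases le_total θ 0 with hθ | hθ
  · rw [abs_of_nonpos hθ] at h3 ⊢
    have h6 := mul_nonneg (neg_nonneg.mpr hθ) ha
    have h7 := mul_nonneg (neg_nonneg.mpr hθ) he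
    linarith
  · rw [abs_of_nonneg hθ] at h3 ⊢
    have h6 := mul_le_mul_of_nonneg_left hpar hθ
    have h7 := mul_nonneg hθ he
    linarith

/-- Double `hmon`, split `c - z = (c - b) + (b - z)` and expand by polarisation. The cross terms of
`u` and of the momentum with `c - b` are split by Young, which produces the coefficient `θ + |θ| +
L` on `‖b - a‖_S²`; the same coefficient in the new energy, with `L'`, accounts for the rest of the
loss. -/
theorem IsStronglyPositive.energy_le (hS : IsStronglyPositive S) {θ L L' r : ℝ} (hL : 0 ≤ L)
    {z a b c u v w : H} (hu : scaledNorm S.inverse u ≤ L * scaledNorm S (b - a))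
    (hmon : 0 ≤ inner ℝ (S (b - c) - v + u + θ • S (b - a) - w) (c - z))
    (hw : -(2 * inner ℝ w (c - z)) ≤ r * inner ℝ (S (c - b)) (c - b)) :
    energy S θ L' z b c v ≤ energy S θ L z a b u
      - (1 - θ - 2 * |θ| - L - L' - r) * inner ℝ (S (c - b)) (c - b) := by
  have h1 := hS.two_mul_abs_inner_le hL hu (c - b)
  have h2 := le_abs_self (inner ℝ u (c - b))
  have h3 := mul_le_mul_of_nonneg_left (hS.two_mul_abs_inner_map_le (b - a) (c - b)) (abs_nonneg θ)
  have h4 : θ * inner ℝ (S (b - a)) (c - b) ≤ |θ| * |inner ℝ (S (b - a)) (c - b)| := by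
    rw [← abs_mul]
    exact le_abs_self _
  unfold energy
  have hcz : c - z = (c - b) + (b - z) := by abel
  have haz : a - z = (b - z) - (b - a) := by abel
  have hbc : b - c = -(c - b) := by abel
  rw [hcz, hbc] at hmon
  rw [hcz] at hw
  rw [hcz, haz]
  have c1 := hS.inner_map_comm (b - z) (b - a)
  have c2 := hS.inner_map_comm (b - z) (c - b)
  generalize b - z = e at *
  generalize b - a = d at *
  generalize c - b = f at *
  simp only [map_add, map_sub, map_neg, inner_add_left, inner_add_right, inner_sub_left,
    inner_sub_right, inner_neg_left, real_inner_smul_left] at *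
  rw [c1, c2]
  linarith

end Energy

/-! ### Asymptotics of the iterates -/

section Iterates

variable {H : Type*} [NormedAddCommGroup H] [InnerProductSpace ℝ H]
  {A : H → Set H} {C : H → H} {S : H →L[ℝ] H} {ℓ : ℝ} {M : ℕ → H → H} {γ L : ℕ → ℝ} {θ ε : ℝ}
  {xm x0 u0 z : H} {x u : ℕ → H}

/-- The element of `(A + C) x_{k+1}` computed by the method. -/
noncomputable def residual (C : H → H) (S : H →L[ℝ] H) (M : ℕ → H → H) (γ : ℕ → ℝ) (θ : ℝ) (xm : H)
    (x u : ℕ → H) (k : ℕ) : H :=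
  M k (x k) - M k (x (k + 1)) + (γ k)⁻¹ • u k + (γ k)⁻¹ • θ • S (x k - prev xm x k)
    + C (x (k + 1)) - C (x k)

theorem IsGenerated.residual_mem (h : IsGenerated A C S M γ θ xm x0 u0 x u) (k : ℕ) :
    residual C S M γ θ xm x u k ∈ addOp A C (x (k + 1)) := by
  refine mem_addOp_iff.mpr ?_
  have h1 := mem_invOp_addOp_iff.mp (h.x_succ k)
  rw [residual]
  convert h1 using 1
  abel

/-- Eliminates `M k` in favour of `S` and the corrections, leaving only quantities that are known to
vanish. -/
theorem IsGenerated.residual_eq (h : IsGenerated A C S M γ θ xm x0 u0 x u) {k : ℕ}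
    (hγ : 0 < γ k) :
    residual C S M γ θ xm x u k =
      (γ k)⁻¹ • (S (x k - x (k + 1)) - u (k + 1) + u k + θ • S (x k - prev xm x k))
        + (C (x (k + 1)) - C (x k)) := by
  have h1 : S (x k - x (k + 1)) - u (k + 1) = γ k • (M k (x k) - M k (x (k + 1))) := by
    rw [h.u_succ k, map_sub, smul_sub]
    abel
  rw [h1, smul_add, smul_add, smul_smul (γ k)⁻¹ (γ k), inv_mul_cancel₀ hγ.ne', one_smul, residual]
  abel

theorem IsGenerated.scaledNorm_correction_le (h : IsGenerated A C S M γ θ xm x0 u0 x u)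
    (hM : ∀ k, IsLipschitzWrt S (L k) (fun y => γ k • M k y - S y)) (k : ℕ) :
    scaledNorm S.inverse (u (k + 1)) ≤ L k * scaledNorm S (x (k + 1) - x k) := by
  rw [h.u_succ k]
  exact (hM k).2 _ _

theorem IsGenerated.tendsto_residual (h : IsGenerated A C S M γ θ xm x0 u0 x u)
    (hγ : ∃ γlow : ℝ, 0 < γlow ∧ ∀ k, γlow ≤ γ k) {κ : ℝ} (hκ : 0 < κ)
    (hC : ∀ x y, κ * ‖C x - C y‖ ^ 2 ≤ inner ℝ (C x - C y) (x - y))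
    (hx : Tendsto (fun n => x (n + 1) - x n) atTop (𝓝 0)) (hu : Tendsto u atTop (𝓝 0)) :
    Tendsto (residual C S M γ θ xm x u) atTop (𝓝 0) := by
  obtain ⟨γlow, hγ0, hγ⟩ := hγ
  have hprev : Tendsto (fun n => x n - prev xm x n) atTop (𝓝 0) := by
    rw [← tendsto_add_atTop_iff_nat 1]
    exact hx
  have hS0 : ∀ {y : ℕ → H}, Tendsto y atTop (𝓝 0) → Tendsto (fun n => S (y n)) atTop (𝓝 0) := by
    intro y hy
    have := (S.continuous.tendsto 0).comp hy
    rwa [map_zero] at this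
  have hx' : Tendsto (fun n => x n - x (n + 1)) atTop (𝓝 0) := by
    simpa using hx.neg
  have hnum : Tendsto (fun n => S (x n - x (n + 1)) - u (n + 1) + u n
      + θ • S (x n - prev xm x n)) atTop (𝓝 0) := by
    have := (((hS0 hx').sub (hu.comp (tendsto_add_atTop_nat 1))).add hu).add
      ((hS0 hprev).const_smul θ)
    simpa using this
  have hCx : Tendsto (fun n => C (x (n + 1)) - C (x n)) atTop (𝓝 0) := by
    have h1 := hx.norm.const_mul κ⁻¹
    rw [norm_zero, mul_zero] at h1
    refine squeeze_zero_norm (fun n => ?_) h1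
    rw [inv_mul_eq_div, le_div_iff₀ hκ]
    rcases (norm_nonneg (C (x (n + 1)) - C (x n))).eq_or_lt with h0 | h0
    · rw [← h0, zero_mul]
      exact norm_nonneg _
    · refine le_of_mul_le_mul_left ?_ h0
      have h2 := (hC (x (n + 1)) (x n)).trans (real_inner_le_norm _ _)
      linarith
  have hres : Tendsto (fun n => (γ n)⁻¹ • (S (x n - x (n + 1)) - u (n + 1) + u n
      + θ • S (x n - prev xm x n))) atTop (𝓝 0) := by
    have h1 := hnum.norm.const_mul γlow⁻¹
    rw [norm_zero, mul_zero] at h1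
    refine squeeze_zero_norm (fun n => ?_) h1
    rw [norm_smul, norm_inv, Real.norm_of_nonneg (hγ0.le.trans (hγ n))]
    exact mul_le_mul_of_nonneg_right (inv_anti₀ hγ0 (hγ n)) (norm_nonneg _)
  have hsum := hres.add hCx
  rw [add_zero] at hsum
  exact hsum.congr fun n => (h.residual_eq (hγ0.trans_le (hγ n))).symm

variable [CompleteSpace H]

/-- The energy is started at `(x_0, x_1, u_1)`: the arbitrary `u_0` and `x_{-1}` need not satisfy
the Lipschitz bound that links a correction to an increment. -/
theorem IsGenerated.energy_succ_le (h : IsGenerated A C S M γ θ xm x0 u0 x u)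
    (hS : IsStronglyPositive S) (hA : IsMaximallyMonotone A)
    (hC : (0 < ℓ ∧ IsCocoerciveWrt S ℓ⁻¹ C) ∨ (C = 0 ∧ ℓ = 0)) (hγ : ∀ k, 0 < γ k)
    (hM : ∀ k, IsLipschitzWrt S (L k) (fun y => γ k • M k y - S y))
    (hcond : ∀ k, ε ≤ 1 - θ - 2 * |θ| - L k - L (k + 1) - γ (k + 1) * (ℓ / 2))
    (hz : z ∈ zer (addOp A C)) (n : ℕ) :
    energy S θ (L (n + 1)) z (x (n + 1)) (x (n + 2)) (u (n + 2)) ≤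
      energy S θ (L n) z (x n) (x (n + 1)) (u (n + 1))
        - ε * inner ℝ (S (x (n + 2) - x (n + 1))) (x (n + 2) - x (n + 1)) := by
  have hzA : 0 - C z ∈ A z := mem_addOp_iff.mp hz
  have hγn := hγ (n + 1)
  refine (hS.energy_le (L' := L (n + 1)) (r := γ (n + 1) * (ℓ / 2)) (c := x (n + 2))
    (v := u (n + 2)) (w := γ (n + 1) • (C (x (n + 1)) - C z)) (hM n).1
    (h.scaledNorm_correction_le hM n) ?_ ?_).trans ?_
  · have h1 := hA.1 (x (n + 2), _) (mem_addOp_iff.mp (h.residual_mem (n + 1))) (z, _) hzA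
    have h2 := mul_nonneg hγn.le h1
    have h3 : S (x (n + 1) - x (n + 2)) - u (n + 2) + u (n + 1) + θ • S (x (n + 1) - x n)
        - γ (n + 1) • (C (x (n + 1)) - C z) =
        γ (n + 1) • (residual C S M γ θ xm x u (n + 1) - C (x (n + 2)) - (0 - C z)) := by
      rw [h.residual_eq hγn, smul_sub, smul_sub, smul_sub, smul_sub, smul_add, smul_sub, smul_smul,
        mul_inv_cancel₀ hγn.ne', one_smul, smul_zero, prev]
      abel
    rw [h3, real_inner_smul_left]
    exact h2
  · have h1 := mul_le_mul_of_nonneg_left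
      (hS.neg_two_mul_inner_le hC (x (n + 1)) (x (n + 2)) z) hγn.le
    rw [real_inner_smul_left]
    linarith
  · have h1 := mul_le_mul_of_nonneg_right (hcond n)
      (hS.inner_map_self_nonneg (x (n + 2) - x (n + 1)))
    linarith

theorem IsStronglyPositive.tendsto_zero_of_inner_map_self (hS : IsStronglyPositive S) {ι : Type*}
    {l : Filter ι} {y : ι → H} (h : Tendsto (fun i => inner ℝ (S (y i)) (y i)) l (𝓝 0)) :
    Tendsto y l (𝓝 0) := by
  obtain ⟨c, hc, hcS⟩ := hS.exists_norm_le
  have h1 := h.sqrt.const_mul c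
  rw [Real.sqrt_zero, mul_zero] at h1
  exact squeeze_zero_norm (fun i => hcS _) h1

theorem IsGenerated.tendsto_energy (h : IsGenerated A C S M γ θ xm x0 u0 x u)
    (hS : IsStronglyPositive S) (hA : IsMaximallyMonotone A)
    (hC : (0 < ℓ ∧ IsCocoerciveWrt S ℓ⁻¹ C) ∨ (C = 0 ∧ ℓ = 0)) (hℓ : 0 ≤ ℓ) (hγ : ∀ k, 0 < γ k)
    (hM : ∀ k, IsLipschitzWrt S (L k) (fun y => γ k • M k y - S y)) (hε : 0 < ε)
    (hcond : ∀ k, ε ≤ 1 - θ - 2 * |θ| - L k - L (k + 1) - γ (k + 1) * (ℓ / 2))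
    (hz : z ∈ zer (addOp A C)) :
    (∃ r, Tendsto (fun n => energy S θ (L n) z (x n) (x (n + 1)) (u (n + 1))) atTop (𝓝 r)) ∧
      Tendsto (fun n => x (n + 1) - x n) atTop (𝓝 0) ∧ ∃ R, ∀ n, ‖x (n + 1) - z‖ ≤ R := by
  set V : ℕ → ℝ := fun n => energy S θ (L n) z (x n) (x (n + 1)) (u (n + 1)) with hV
  have hdec : ∀ n, V (n + 1) ≤
      V n - ε * inner ℝ (S (x (n + 2) - x (n + 1))) (x (n + 2) - x (n + 1)) :=
    h.energy_succ_le hS hA hC hγ hM hcond hz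
  have hlow : ∀ n, ε * inner ℝ (S (x (n + 1) - z)) (x (n + 1) - z) ≤ V n := by
    intro n
    refine hS.mul_le_energy (hM n).1 ?_ (h.scaledNorm_correction_le hM n)
    have h1 := mul_nonneg (hγ (n + 1)).le (div_nonneg hℓ zero_le_two)
    have h2 := hcond n
    have h3 := (hM (n + 1)).1
    linarith
  have hV0 : ∀ n, 0 ≤ V n := fun n =>
    (mul_nonneg hε.le (hS.inner_map_self_nonneg _)).trans (hlow n)
  have hanti : Antitone V := antitone_nat_of_succ_le fun n =>
    (hdec n).trans (sub_le_self _ (mul_nonneg hε.le (hS.inner_map_self_nonneg _)))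
  have hlim := tendsto_atTop_ciInf hanti ⟨0, by rintro _ ⟨n, rfl⟩; exact hV0 n⟩
  refine ⟨⟨_, hlim⟩, ?_, ?_⟩
  · rw [← tendsto_add_atTop_iff_nat 1]
    refine hS.tendsto_zero_of_inner_map_self ?_
    have h1 := (hlim.sub (hlim.comp (tendsto_add_atTop_nat 1))).const_mul ε⁻¹
    rw [sub_self, mul_zero] at h1
    refine squeeze_zero (fun n => hS.inner_map_self_nonneg _) (fun n => ?_) h1
    have h2 := hdec n
    rw [Function.comp_apply, inv_mul_eq_div, le_div_iff₀ hε]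
    linarith
  · obtain ⟨c, hc, hcS⟩ := hS.exists_norm_le
    refine ⟨c * √(ε⁻¹ * V 0), fun n => (hcS _).trans ?_⟩
    refine mul_le_mul_of_nonneg_left (Real.sqrt_le_sqrt ?_) hc.le
    rw [inv_mul_eq_div, le_div_iff₀ hε, mul_comm]
    exact (hlow n).trans (hanti n.zero_le)

theorem IsGenerated.tendsto_correction (h : IsGenerated A C S M γ θ xm x0 u0 x u)
    (hS : IsStronglyPositive S) (hM : ∀ k, IsLipschitzWrt S (L k) (fun y => γ k • M k y - S y))
    (hL : ∀ k, L k ≤ 1) (hx : Tendsto (fun n => x (n + 1) - x n) atTop (𝓝 0)) :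
    Tendsto u atTop (𝓝 0) := by
  rw [← tendsto_add_atTop_iff_nat 1]
  obtain ⟨c, hc, hcS⟩ := hS.exists_norm_le_inverse
  have h1 := (((continuous_scaledNorm S).tendsto 0).comp hx).const_mul c
  rw [show scaledNorm S 0 = 0 by simp [scaledNorm], mul_zero] at h1
  refine squeeze_zero_norm (fun n => (hcS _).trans ?_) h1
  refine mul_le_mul_of_nonneg_left ((h.scaledNorm_correction_le hM n).trans ?_) hc.le
  exact mul_le_of_le_one_left (scaledNorm_nonneg _ _) (hL n)

/-- Convergence of the energy implies convergence of the scaled distance to `z`. -/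
theorem IsStronglyPositive.exists_tendsto_of_energy (hS : IsStronglyPositive S) (hθ : θ < 1)
    (hL0 : ∀ k, 0 ≤ L k) (hL : ∀ k, L k ≤ 1) {r R : ℝ}
    (hV : Tendsto (fun n => energy S θ (L n) z (x n) (x (n + 1)) (u (n + 1))) atTop (𝓝 r))
    (hx : Tendsto (fun n => x (n + 1) - x n) atTop (𝓝 0)) (hu : Tendsto u atTop (𝓝 0))
    (hR : ∀ n, ‖x (n + 1) - z‖ ≤ R) :
    ∃ s : ℝ, Tendsto (fun n => inner ℝ (S (x (n + 1) - z)) (x (n + 1) - z)) atTop (𝓝 s) := by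
  have hSx : Tendsto (fun n => S (x (n + 1) - x n)) atTop (𝓝 0) := by
    have := (S.continuous.tendsto 0).comp hx
    rwa [map_zero] at this
  have h1 := tendsto_inner_zero_of_norm_le (hu.comp (tendsto_add_atTop_nat 1)) hR
  have h2 := tendsto_inner_zero_of_norm_le hSx hR
  have h3 : Tendsto (fun n => (inner ℝ (S (x (n + 1) - x n)) (x (n + 1) - x n) : ℝ)) atTop
      (𝓝 0) := by
    simpa using hSx.inner (𝕜 := ℝ) hx
  -- `L n` need not converge, but it is bounded by `1`, which suffices.
  have h4 : Tendsto (fun n => (θ + |θ| + L n)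
      * inner ℝ (S (x (n + 1) - x n)) (x (n + 1) - x n)) atTop (𝓝 0) := by
    have h5 := h3.const_mul (θ + |θ| + 1)
    rw [mul_zero] at h5
    have hθ' := neg_abs_le θ
    refine squeeze_zero (fun n => mul_nonneg ?_ (hS.inner_map_self_nonneg _))
      (fun n => mul_le_mul_of_nonneg_right ?_ (hS.inner_map_self_nonneg _)) h5
    · linarith [hL0 n]
    · linarith [hL n]
  -- Expanding `x n - z` around `x (n + 1) - z` leaves `1 - θ` times the wanted square plus
  -- vanishing terms; `θ < 1` allows the division.
  have h6 := ((((hV.sub (h1.const_mul 2)).sub ((h2.const_mul 2).const_mul θ)).add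
    (h3.const_mul θ)).sub h4).div_const (1 - θ)
  refine ⟨_, h6.congr fun n => ?_⟩
  rw [div_eq_iff (sub_pos.mpr hθ).ne', Function.comp_apply, energy,
    show x n - z = (x (n + 1) - z) - (x (n + 1) - x n) by abel]
  have h7 := hS.inner_map_comm (x (n + 1) - z) (x (n + 1) - x n)
  generalize x (n + 1) - z = e at *
  generalize x (n + 1) - x n = d at *
  simp only [map_sub, inner_sub_left, inner_sub_right]
  rw [h7]
  ring

end Iterates

end NonlinearFB

theorem corollary4p1 {H : Type*} [NormedAddCommGroup H] [InnerProductSpace ℝ H] [CompleteSpace H]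
    (A : H → Set H) (C : H → H) (S : H →L[ℝ] H) (ℓ : ℝ)
    (M : ℕ → H → H) (γ L : ℕ → ℝ) (θ : ℝ)
    (hS : NonlinearFB.IsStronglyPositive S)
    (hA : NonlinearFB.IsMaximallyMonotone A)
    (hC : (0 < ℓ ∧ NonlinearFB.IsCocoerciveWrt S ℓ⁻¹ C) ∨ (C = 0 ∧ ℓ = 0))
    (hzer : (NonlinearFB.zer (NonlinearFB.addOp A C)).Nonempty)
    (hγ : ∃ γlow : ℝ, 0 < γlow ∧ ∀ k : ℕ, γlow ≤ γ k)
    (hM : ∀ k : ℕ, NonlinearFB.IsLipschitzWrt S (L k) (fun x => γ k • M k x - S x))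
    (hθ : θ < 1)
    (hcond : ∃ ε : ℝ, 0 < ε ∧ ∀ k : ℕ,
      ε ≤ 1 - θ - 2 * |θ| - L k - L (k + 1) - γ (k + 1) * (ℓ / 2))
    (xm x0 u0 : H) :
    (∃! p : (ℕ → H) × (ℕ → H), NonlinearFB.IsGenerated A C S M γ θ xm x0 u0 p.1 p.2) ∧
    ∀ x u : ℕ → H, NonlinearFB.IsGenerated A C S M γ θ xm x0 u0 x u →
      Tendsto (fun k : ℕ => x (k + 1) - x k) atTop (𝓝 0) ∧
      Tendsto u atTop (𝓝 0) ∧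
      (∀ k : ℕ, M k (x k) - M k (x (k + 1)) + (γ k)⁻¹ • u k
          + (γ k)⁻¹ • θ • S (x k - NonlinearFB.prev xm x k) + C (x (k + 1)) - C (x k)
          ∈ NonlinearFB.addOp A C (x (k + 1))) ∧
      Tendsto (fun k : ℕ => M k (x k) - M k (x (k + 1)) + (γ k)⁻¹ • u k
          + (γ k)⁻¹ • θ • S (x k - NonlinearFB.prev xm x k) + C (x (k + 1)) - C (x k))
          atTop (𝓝 0) ∧
      ∃ xstar ∈ NonlinearFB.zer (NonlinearFB.addOp A C),
        Tendsto (fun k : ℕ => toWeakSpace ℝ H (x k)) atTop (𝓝 (toWeakSpace ℝ H xstar)) := by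
  obtain ⟨ε, hε, hcond⟩ := hcond
  have hγ0 : ∀ k, 0 < γ k := by
    obtain ⟨γlow, h0, h⟩ := hγ
    exact fun k => h0.trans_le (h k)
  have hℓ : 0 ≤ ℓ := by
    rcases hC with ⟨h, -⟩ | ⟨-, h⟩
    · exact h.le
    · exact h.ge
  have hL1 : ∀ k, L k < 1 := by
    intro k
    have h1 := hcond k
    have h2 := (hM (k + 1)).1
    have h3 := mul_nonneg (hγ0 (k + 1)).le (div_nonneg hℓ zero_le_two)
    have h4 := neg_abs_le θ
    have h5 := abs_nonneg θ
    linarith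
  refine ⟨NonlinearFB.existsUnique_isGenerated
    (fun k => hS.existsUnique_mem_invOp hA (hγ0 k) (hL1 k) (hM k)) xm x0 u0, fun x u h => ?_⟩
  obtain ⟨κ, hκ, hCκ⟩ := hS.exists_norm_cocoercive hC
  have hall := fun z (hz : z ∈ NonlinearFB.zer (NonlinearFB.addOp A C)) =>
    h.tendsto_energy hS hA hC hℓ hγ0 hM hε hcond hz
  obtain ⟨z, hz⟩ := hzer
  obtain ⟨-, hx, R, hR⟩ := hall z hz
  have hu := h.tendsto_correction hS hM (fun k => (hL1 k).le) hx
  have hg := h.tendsto_residual hγ hκ hCκ hx hu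
  have hbd : ∀ n, ‖x (n + 1)‖ ≤ R + ‖z‖ := fun n => by
    have := norm_add_le (x (n + 1) - z) z
    rw [sub_add_cancel] at this
    linarith [hR n]
  refine ⟨hx, hu, h.residual_mem, hg, ?_⟩
  -- Opial's lemma is applied to the shifted sequence, since the `k`-th residual belongs to `(A + C)
  -- x_{k+1}`.
  obtain ⟨p, hp, hlim⟩ := hS.exists_tendsto_inner hbd
    (fun z hz => by
      obtain ⟨⟨r, hr⟩, -, R, hR⟩ := hall z hz
      exact hS.exists_tendsto_of_energy hθ (fun k => (hM k).1) (fun k => (hL1 k).le) hr hx hu hR)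
    (fun U hU p hp => NonlinearFB.mem_zer_addOp_of_tendsto hA hκ hCκ hz hbd hp h.residual_mem
      (hg.mono_left hU))
  refine ⟨p, hp, ?_⟩
  rw [← tendsto_add_atTop_iff_nat 1]
  exact NonlinearFB.tendsto_toWeakSpace_of_inner hlim
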